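/- An index coding problem has independent messages $W_1,\dots,W_M$ and destinations $D_k=(\mathcal W_k,\mathcal A_k)$, $k=1,\dots,K$, where $\mathcal W_k$ is the set of messages desired by $D_k$, $\mathcal A_k$ is the set of messages available to $D_k$ as side information (antidotes), and $\mathcal W_k\cap\mathcal A_k=\emptyset$. A message may be desired by several destinations (groupcast); the problem is multiple unicast if no message is desired by more than one destination. An $(\mathcal S,n,\overline R)$ scheme has a finite alphabet $\mathcal S$ with $|\mathcal S|>1$, a number $n\ge 1$ of channel uses, independent messages $W_m$ uniform on $|\mathcal S|^{n\overline R_m}$ values, an encoder mapping all messages to $S^n\in\mathcal S^n$, and, for each $k$ and each desired message in $\mathcal W_k$, a decoder acting on $S^n$ and the messages in $\mathcal A_k$; its error probability is the probability that some desired message is decoded incorrectly. A rate tuple $(R_m)$ is achievable if for all $\epsilon,\delta>0$ there is a scheme with error probability at most $\epsilon$ and $\overline R_m\ge R_m-\delta$ for all $m$. A linear scheme over a finite field $\mathbb F$ consists of $n\ge1$, integers $L_m\ge 0$, matrices $\mathbf V_m\in\mathbb F^{n\times L_m}$ and, whenever $W_m\in\mathcal W_k$, matrices $\mathbf U_{m,k}\in\mathbb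 F^{L_m\times n}$ such that $\mathbf U_{m,k}\mathbf V_i=0$ whenever $W_m\in\mathcal W_k$, $i\neq m$, $W_i\notin\mathcal A_k$, and $\det(\mathbf U_{m,k}\mathbf V_m)\ne0$ whenever $W_m\in\mathcal W_k$; its rates are $L_m/n$. A rate tuple $(R_m)$ is linearly achievable if for every $\delta>0$ there is a linear scheme (over some finite field) with $L_m/n\ge R_m-\delta$ for all $m$. Construction. Consider a groupcast index coding problem in which every message is desired by at least one destination. Choose $L$ and, for each message $W_i$, a list $k(i,1),\dots,k(i,L)$, possibly with repetitions, of exactly the (indices of) destinations that desire $W_i$; such a choice exists. (That is, a destination desiring several messages is replaced by copies of itself, each desiring one message, and virtual copies of destinations are added until every message is desired by exactly $L$ destinations.) The equivalent problem has messages $\overline W_{i,j}$ and destinations $\overline D_{i,j}$, $1\le i\le M$, $0\le j\le L$; destination $\overline D_{i,j}$ desires exactly $\overline W_{i,j}$ and has the antidotes $$\overline{\mathcal A}_{i,j}=\{\overline W_{m,l}: W_m\in\mathcal A_{k(i,j)},\ 0\le l\le L\}\cup\{\overline W_{m,0}:1\le m\le M\}\cup\{\overline W_{i,l}: l\ne j\}\quad(j\ne0),$$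 $$\overline{\mathcal A}_{i,0}=\{\overline W_{m,l}: m\ne i,\ 0\le l\le L\}.$$ The messages and destinations with $j=0$ are called auxiliary. Theorem. For every groupcast index coding problem in which every message is desired by at least one destination, and for every choice in the construction, the equivalent problem is a multiple unicast index coding problem, and for every tuple $(R_1,\dots,R_M)$ of nonnegative rates, with $$R_{i,j}=\begin{cases}R_i, & j\neq0,\\ 1-R_i, & j=0,\end{cases}$$ the following hold. 1. If $(R_i)$ is achievable in the groupcast problem, then $(R_{i,j})$ is achievable in the equivalent multiple unicast problem. 2. $(R_i)$ is linearly achievable in the groupcast problem if and only if $(R_{i,j})$ is linearly achievable in the equivalent multiple unicast problem. -/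

import Mathlib

/-- An index coding problem with messages indexed by `ι` and destinations indexed by `κ`:
destination `k` desires the messages in `desired k` and has the messages in `antidotes k` as side
information.  A message may be desired by several destinations (multiple groupcast). -/
structure IndexCodingProblem (ι κ : Type) where
  desired : κ → Set ι
  antidotes : κ → Set ι
  disjoint : ∀ k, Disjoint (desired k) (antidotes k)

namespace IndexCodingProblem

/-- No message is desired by more than one destination. -/
def IsMultipleUnicast {ι κ : Type} (P : IndexCodingProblem ι κ) : Prop :=
  ∀ k₁ k₂, k₁ ≠ k₂ → P.desired k₁ ∩ P.desired k₂ = ∅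

/-- An `(S, n, R)` index coding scheme.  Message `m` takes `size m = |S| ^ (n R_m)` values.  The
encoder maps the message tuple to `n` symbols; the decoder for message `m` at destination `k` sees
those symbols and the values of the antidotes of `k`. -/
structure Scheme {ι κ : Type} (P : IndexCodingProblem ι κ) (S : Type) [Fintype S] (n : ℕ)
    (R : ι → ℝ) where
  one_lt_card : 1 < Fintype.card S
  n_pos : 0 < n
  size : ι → ℕ
  size_eq : ∀ m, (size m : ℝ) = (Fintype.card S : ℝ) ^ ((n : ℝ) * R m)
  encode : (∀ m, Fin (size m)) → (Fin n → S)
  decode : ∀ k m, m ∈ P.desired k →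
    (Fin n → S) → (∀ a : P.antidotes k, Fin (size a)) → Fin (size m)

/-- On the message tuple `w`, every destination decodes all its desired messages correctly. -/
def Scheme.Correct {ι κ : Type} {P : IndexCodingProblem ι κ} {S : Type} [Fintype S] {n : ℕ}
    {R : ι → ℝ} (C : P.Scheme S n R) (w : ∀ m, Fin (C.size m)) : Prop :=
  ∀ k m, ∀ h : m ∈ P.desired k, C.decode k m h (C.encode w) (fun a => w a) = w m

/-- The probability that some desired message is decoded incorrectly, for independent messages
uniformly distributed over their ranges: the message tuple is then uniformly distributed over
`∏ m, size m` values. -/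
noncomputable def Scheme.errorProb {ι κ : Type} [Fintype ι] {P : IndexCodingProblem ι κ} {S : Type}
    [Fintype S] {n : ℕ} {R : ι → ℝ} (C : P.Scheme S n R) : ℝ :=
  1 - (Set.ncard {w | C.Correct w} : ℝ) / ((∏ m, C.size m : ℕ) : ℝ)

/-- Achievability of a rate tuple, with vanishing probability of error. -/
def Achievable {ι κ : Type} [Fintype ι] (P : IndexCodingProblem ι κ) (R : ι → ℝ) : Prop :=
  ∀ ε δ : ℝ, 0 < ε → 0 < δ →
    ∃ (S : Type) (_ : Fintype S) (n : ℕ) (R' : ι → ℝ) (C : P.Scheme S n R'),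
      (∀ m, R m - δ ≤ R' m) ∧ C.errorProb ≤ ε

/-- A (vector) linear index coding scheme over the finite field `F` with `n` channel uses and
rates `R_m = len m / n`: precoding matrices `V m` and receiver combining matrices `U m k` (used
only when `k` desires `m`). -/
structure LinearScheme {ι κ : Type} (P : IndexCodingProblem ι κ) (F : Type) [Field F] [Fintype F]
    (n : ℕ) (R : ι → ℝ) where
  n_pos : 0 < n
  len : ι → ℕ
  rate_eq : ∀ m, R m = (len m : ℝ) / (n : ℝ)
  V : ∀ m, Matrix (Fin n) (Fin (len m)) F
  U : ∀ m, κ → Matrix (Fin (len m)) (Fin n) F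
  zero_forcing : ∀ m i k, m ≠ i → m ∈ P.desired k → i ∉ P.antidotes k → U m k * V i = 0
  det_ne_zero : ∀ m k, m ∈ P.desired k → (U m k * V m).det ≠ 0

/-- Achievability of a rate tuple via linear coding (linear schemes have zero error). -/
def LinearlyAchievable {ι κ : Type} (P : IndexCodingProblem ι κ) (R : ι → ℝ) : Prop :=
  ∀ δ : ℝ, 0 < δ →
    ∃ (F : Type) (_ : Field F) (_ : Fintype F) (n : ℕ) (R' : ι → ℝ) (_ : P.LinearScheme F n R'),
      ∀ m, R m - δ ≤ R' m

/-- For each message `m`, a list of length `L`, possibly with repetitions, of exactly the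
destinations that desire `m`. -/
structure Listing {M K : ℕ} (P : IndexCodingProblem (Fin M) (Fin K)) (L : ℕ) where
  dest : Fin M → Fin L → Fin K
  mem_desired_iff : ∀ m k, m ∈ P.desired k ↔ ∃ l, dest m l = k

/-- The groupcast problem in which every destination desires one message and every message is
desired by `L` destinations.  Destinations that desire several messages are split into copies of
themselves, one for each desired message, and virtual copies are added, as prescribed by `E`.
Destination `(m, l)` desires message `m`. -/
def uniform {M K : ℕ} (P : IndexCodingProblem (Fin M) (Fin K)) {L : ℕ} (E : P.Listing L) :
    IndexCodingProblem (Fin M) (Fin M × Fin L) where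
  desired d := {d.1}
  antidotes d := P.antidotes (E.dest d.1 d.2)
  disjoint d := Set.disjoint_singleton_left.2 fun h =>
    Set.disjoint_left.1 (P.disjoint _) ((E.mem_desired_iff d.1 _).2 ⟨d.2, rfl⟩) h

/-- The multiple unicast problem built from a groupcast problem in which destination `(m, l)`
desires exactly message `m`.  Messages and destinations are indexed by pairs `(i, j)` with
`0 ≤ j ≤ L`; those with `j = 0` are the auxiliary ones.  For `l : Fin L`, the index `j = l.succ`
corresponds to destination `(i, l)` of the groupcast problem. -/
def unicast {M L : ℕ} (Q : IndexCodingProblem (Fin M) (Fin M × Fin L))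
    (hQ : ∀ d, Q.desired d = {d.1}) :
    IndexCodingProblem (Fin M × Fin (L + 1)) (Fin M × Fin (L + 1)) where
  desired d := {d}
  antidotes d := Fin.cases (motive := fun _ => Set (Fin M × Fin (L + 1)))
    {w | w.1 ≠ d.1}
    (fun l => {w | w.1 ∈ Q.antidotes (d.1, l)} ∪ {w | w.2 = 0} ∪ {w | w.1 = d.1 ∧ w.2 ≠ l.succ})
    d.2
  disjoint := by
    rintro ⟨i, j⟩
    rw [Set.disjoint_singleton_left]
    induction j using Fin.cases with
    | zero => simp
    | succ l =>
      have h : i ∉ Q.antidotes (i, l) :=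
        Set.disjoint_singleton_left.1 (hQ (i, l) ▸ Q.disjoint (i, l))
      simp [h]

/-- The multiple unicast problem equivalent to `P`. -/
def equivalentUnicast {M K : ℕ} (P : IndexCodingProblem (Fin M) (Fin K)) {L : ℕ}
    (E : P.Listing L) : IndexCodingProblem (Fin M × Fin (L + 1)) (Fin M × Fin (L + 1)) :=
  (P.uniform E).unicast fun _ => rfl

/-- `R_{i,j} = R_i` for `j ≠ 0` and `R_{i,0} = 1 - R_i`. -/
noncomputable def unicastRates {M : ℕ} (L : ℕ) (R : Fin M → ℝ) : Fin M × Fin (L + 1) → ℝ :=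
  fun w => if w.2 = 0 then 1 - R w.1 else R w.1

end IndexCodingProblem

/-! Linear part. Up to a choice of bases, a linear scheme is a family of subspaces satisfying
`Resolves`. From groupcast to unicast, every (i, j) with j ≠ 0 reuses the space of message i, and
(i, 0) gets a complement of it. Conversely, destination (i, 0) has all of row i as interference, so
the spaces of (i, j), j ≠ 0, together span at most about R_i n dimensions. Each of them already has
nearly that dimension, so they nearly coincide, and their intersection (`finrank_iInf_fin`) can
carry message i.

General part. Let `f` be a groupcast encoder with q outputs. The unicast encoder sends f(a + e(σ)) +
∑ g_i(w(i, 0)), where σ_i is the sum of the w(i, j), j ≠ 0, in a cyclic group, `e` embeds that group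
into the alphabet of message i, `a` is a shift and `g` a codebook. Destination (i, j), j ≠ 0,
removes the auxiliary terms, decodes σ_i as in the groupcast problem, and subtracts the other
summands. Destination (i, 0) knows everything outside row i; for a random codebook a wrong value of
w(i, 0), paired with any row sum, collides with the truth with probability at most 1/q, and there
are only O(q^(1-δ)) such pairs. The random shift is needed because the embedded sums fill only part
of the alphabet, where `f` might fail. Averaging (`exists_shift_codebook`) fixes `a` and `g`;
repeating the groupcast scheme makes q large. -/

namespace IndexCodingProblem

open Module

/-! ### Linear schemes as configurations of subspaces -/

/-- The subspaces `T m` carry the messages: at each destination, the signal space of a desired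
message is disjoint from the span of the signal spaces of the interfering ones. -/
def Resolves {ι κ : Type} (P : IndexCodingProblem ι κ) {F E : Type} [Field F] [AddCommGroup E]
    [Module F E] (T : ι → Submodule F E) : Prop :=
  ∀ k m, m ∈ P.desired k →
    Disjoint (T m) (⨆ i, ⨆ (_ : i ≠ m ∧ i ∉ P.antidotes k), T i)

/-- Take the column spaces of the precoders. The kernel of `U m k` contains all interference, while
invertibility of `U m k * V m` keeps it away from the range of `V m` and makes `V m` injective. An
undesired message could have a rank-deficient precoder, hence `hP`. -/
theorem LinearScheme.exists_resolves {ι κ : Type} {P : IndexCodingProblem ι κ} {F : Type} [Field F]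
    [Fintype F] {n : ℕ} {R : ι → ℝ} (C : P.LinearScheme F n R)
    (hP : ∀ m, ∃ k, m ∈ P.desired k) :
    ∃ T : ι → Submodule F (Fin n → F), P.Resolves T ∧ ∀ m, (finrank F (T m) : ℝ) = n * R m := by
  have hinj : ∀ m k, m ∈ P.desired k → ∀ x, (C.U m k).mulVec ((C.V m).mulVec x) = 0 → x = 0 := by
    intro m k hm x hx
    rw [Matrix.mulVec_mulVec] at hx
    exact Matrix.eq_zero_of_mulVec_eq_zero (C.det_ne_zero m k hm) hx
  refine ⟨fun m => LinearMap.range (C.V m).mulVecLin, ?_, ?_⟩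
  · intro k m hm
    have hker : (⨆ i, ⨆ (_ : i ≠ m ∧ i ∉ P.antidotes k), LinearMap.range (C.V i).mulVecLin) ≤
        LinearMap.ker (C.U m k).mulVecLin := by
      refine iSup₂_le fun i hi => ?_
      rintro _ ⟨x, rfl⟩
      simp [Matrix.mulVec_mulVec, C.zero_forcing m i k hi.1.symm hm hi.2]
    refine Disjoint.mono_right hker ?_
    rw [Submodule.disjoint_def]
    rintro _ ⟨x, rfl⟩ hx
    have : x = 0 := hinj m k hm x (by simpa using hx)
    simp [this]
  · intro m
    obtain ⟨k, hk⟩ := hP m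
    have hn : (n : ℝ) ≠ 0 := by exact_mod_cast C.n_pos.ne'
    rw [LinearMap.finrank_range_of_inj, C.rate_eq m]
    · simp; field_simp
    · rw [injective_iff_map_eq_zero]
      intro x hx
      refine hinj m k hk x ?_
      rw [Matrix.mulVecLin_apply] at hx
      simp [hx]

/-- With I the interference space, `T m` embeds in E/I. A left inverse of this embedding, composed
with the quotient map, kills the interference and fixes `T m`; its matrix is the combiner. -/
theorem Resolves.nonempty_linearScheme {ι κ : Type} {P : IndexCodingProblem ι κ} {F E : Type}
    [Field F] [Fintype F] [AddCommGroup E] [Module F E] [FiniteDimensional F E] [Nontrivial E]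
    {T : ι → Submodule F E} (hT : P.Resolves T) :
    Nonempty (P.LinearScheme F (finrank F E)
      fun m => (finrank F (T m) : ℝ) / (finrank F E : ℝ)) := by
  classical
  let b := finBasis F E
  let c := fun m => finBasis F (T m)
  have hproj : ∀ m k, ∃ u : E →ₗ[F] T m, m ∈ P.desired k →
      (∀ x : T m, u x = x) ∧ ∀ i, i ≠ m → i ∉ P.antidotes k → ∀ x ∈ T i, u x = 0 := by
    intro m k
    by_cases hm : m ∈ P.desired k
    · set I := ⨆ i, ⨆ (_ : i ≠ m ∧ i ∉ P.antidotes k), T i with hI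
      have hker : LinearMap.ker (I.mkQ ∘ₗ (T m).subtype) = ⊥ := by
        rw [LinearMap.ker_eq_bot']
        intro x hx
        have hxI : (x : E) ∈ I := by simpa using hx
        exact Subtype.ext (Submodule.disjoint_def.1 (hT k m hm) x x.2 hxI)
      obtain ⟨g, hg⟩ := LinearMap.exists_leftInverse_of_injective _ hker
      refine ⟨g ∘ₗ I.mkQ, fun _ => ⟨fun x => by simpa using LinearMap.congr_fun hg x, ?_⟩⟩
      intro i hi hk x hx
      have hxI : x ∈ I := (le_iSup₂_of_le (f := fun i _ => T i) i ⟨hi, hk⟩ le_rfl) hx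
      have : I.mkQ x = 0 := by simpa using hxI
      rw [LinearMap.comp_apply, this, map_zero]
    · exact ⟨0, fun h => absurd h hm⟩
  choose u hu using hproj
  refine ⟨{
    n_pos := finrank_pos
    len := fun m => finrank F (T m)
    rate_eq := fun m => rfl
    V := fun m => LinearMap.toMatrix (c m) b (T m).subtype
    U := fun m k => LinearMap.toMatrix b (c m) (u m k)
    zero_forcing := ?_
    det_ne_zero := ?_ }⟩
  · intro m i k hmi hm hi
    have h0 : u m k ∘ₗ (T i).subtype = 0 :=
      LinearMap.ext fun x => (hu m k hm).2 i hmi.symm hi x x.2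
    rw [← LinearMap.toMatrix_comp, h0, map_zero]
  · intro m k hm
    have h1 : u m k ∘ₗ (T m).subtype = LinearMap.id :=
      LinearMap.ext fun x => (hu m k hm).1 x
    rw [← LinearMap.toMatrix_comp, h1, LinearMap.toMatrix_id, Matrix.det_one]
    exact one_ne_zero

/-- Linear achievability, in terms of signal spaces of large dimension. -/
theorem linearlyAchievable_of_resolves {ι κ : Type} {P : IndexCodingProblem ι κ} {R : ι → ℝ}
    (h : ∀ δ : ℝ, 0 < δ → ∃ (F : Type) (_ : Field F) (_ : Fintype F) (E : Type)
      (_ : AddCommGroup E) (_ : Module F E) (_ : FiniteDimensional F E) (_ : Nontrivial E)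
      (T : ι → Submodule F E), P.Resolves T ∧
        ∀ m, (R m - δ) * finrank F E ≤ finrank F (T m)) :
    P.LinearlyAchievable R := by
  intro δ hδ
  obtain ⟨F, _, _, E, _, _, _, _, T, hT, hR⟩ := h δ hδ
  obtain ⟨C⟩ := hT.nonempty_linearScheme
  refine ⟨F, _, _, _, _, C, fun m => ?_⟩
  have hn : (0 : ℝ) < finrank F E := by exact_mod_cast finrank_pos
  exact (le_div_iff₀ hn).2 (hR m)

theorem LinearlyAchievable.exists_resolves {ι κ : Type} {P : IndexCodingProblem ι κ} {R : ι → ℝ}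
    (h : P.LinearlyAchievable R) (hP : ∀ m, ∃ k, m ∈ P.desired k) {δ : ℝ} (hδ : 0 < δ) :
    ∃ (F : Type) (_ : Field F) (_ : Fintype F) (n : ℕ) (T : ι → Submodule F (Fin n → F)),
      0 < n ∧ P.Resolves T ∧ ∀ m, (R m - δ) * n ≤ finrank F (T m) := by
  obtain ⟨F, _, _, n, R', C, hR⟩ := h δ hδ
  obtain ⟨T, hT, hd⟩ := C.exists_resolves hP
  refine ⟨F, inferInstance, inferInstance, n, T, C.n_pos, hT, fun m => ?_⟩
  rw [hd, mul_comm]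
  exact mul_le_mul_of_nonneg_left (hR m) n.cast_nonneg

theorem Resolves.mono {ι κ : Type} {P : IndexCodingProblem ι κ} {F E : Type}
    [Field F] [AddCommGroup E] [Module F E] {T T' : ι → Submodule F E} (hT : P.Resolves T)
    (h : ∀ m, T' m ≤ T m) : P.Resolves T' :=
  fun k m hm => (hT k m hm).mono (h m) (iSup₂_mono fun i _ => h i)

/-- Using the channel `t` times as often. -/
theorem Resolves.pi {ι κ : Type} {P : IndexCodingProblem ι κ} {F E : Type}
    [Field F] [AddCommGroup E] [Module F E] {T : ι → Submodule F E} (hT : P.Resolves T) (t : ℕ) :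
    P.Resolves fun m => Submodule.pi (Set.univ : Set (Fin t)) fun _ => T m := by
  intro k m hm
  have hle : (⨆ i, ⨆ (_ : i ≠ m ∧ i ∉ P.antidotes k),
      Submodule.pi (Set.univ : Set (Fin t)) fun _ => T i) ≤
      Submodule.pi (Set.univ : Set (Fin t)) fun _ =>
        ⨆ i, ⨆ (_ : i ≠ m ∧ i ∉ P.antidotes k), T i :=
    iSup₂_le fun i hi x hx s hs =>
      (le_iSup₂_of_le (f := fun i _ => T i) i hi le_rfl) (hx s hs)
  refine Disjoint.mono_right hle ?_
  rw [Submodule.disjoint_def]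
  intro x hx hx'
  funext s
  exact Submodule.disjoint_def.1 (hT k m hm) _ (hx s trivial) (hx' s trivial)

theorem finrank_pi_const {F E : Type} [Field F] [AddCommGroup E] [Module F E]
    [FiniteDimensional F E] (p : Submodule F E) (t : ℕ) :
    finrank F (Submodule.pi (Set.univ : Set (Fin t)) fun _ => p) = t * finrank F p := by
  let e : (Fin t → p) ≃ₗ[F] Submodule.pi (Set.univ : Set (Fin t)) fun _ => p :=
    { toFun := fun x => ⟨fun s => x s, fun s _ => (x s).2⟩
      invFun := fun x s => ⟨x.1 s, x.2 s trivial⟩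
      map_add' := fun _ _ => rfl
      map_smul' := fun _ _ => rfl
      left_inv := fun _ => rfl
      right_inv := fun _ => rfl }
  rw [← e.finrank_eq, finrank_pi_fintype]
  simp

theorem exists_le_finrank_eq {F E : Type} [Field F] [AddCommGroup E] [Module F E]
    {p : Submodule F E} {d : ℕ} (h : d ≤ finrank F p) : ∃ q ≤ p, finrank F q = d := by
  obtain ⟨f, hf⟩ := exists_linearIndependent_of_le_finrank h
  refine ⟨Submodule.span F (Set.range fun i => (f i : E)), ?_, ?_⟩
  · rw [Submodule.span_le]
    rintro _ ⟨i, rfl⟩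
    exact (f i).2
  · exact (finrank_span_eq_card (hf.map' p.subtype p.ker_subtype)).trans (Fintype.card_fin d)

/-! ### Linear achievability in the two problems -/

theorem mem_antidotes_equivalentUnicast_zero {M K L : ℕ} {P : IndexCodingProblem (Fin M) (Fin K)}
    {E : P.Listing L} {i : Fin M} {w : Fin M × Fin (L + 1)} :
    w ∈ (P.equivalentUnicast E).antidotes (i, 0) ↔ w.1 ≠ i :=
  Iff.rfl

theorem mem_antidotes_equivalentUnicast_succ {M K L : ℕ} {P : IndexCodingProblem (Fin M) (Fin K)}
    {E : P.Listing L} {i : Fin M} {l : Fin L} {w : Fin M × Fin (L + 1)} :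
    w ∈ (P.equivalentUnicast E).antidotes (i, l.succ) ↔
      (w.1 ∈ P.antidotes (E.dest i l) ∨ w.2 = 0) ∨ w.1 = i ∧ w.2 ≠ l.succ :=
  Iff.rfl

theorem mem_desired_equivalentUnicast {M K L : ℕ} {P : IndexCodingProblem (Fin M) (Fin K)}
    {E : P.Listing L} {d w : Fin M × Fin (L + 1)} :
    w ∈ (P.equivalentUnicast E).desired d ↔ w = d :=
  Iff.rfl

/-- Destination (i, 0) sees interference only from row i, all of it in `T i`. Destination (i, j), j
≠ 0, sees only the spaces of messages m ≠ i that already interfere at the groupcast destination. -/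
theorem Resolves.equivalentUnicast {M K L : ℕ} {P : IndexCodingProblem (Fin M) (Fin K)}
    {E : P.Listing L} {F V : Type} [Field F] [AddCommGroup V] [Module F V]
    {T T₀ : Fin M → Submodule F V} (hT : P.Resolves T) (h₀ : ∀ i, Disjoint (T₀ i) (T i)) :
    (P.equivalentUnicast E).Resolves fun w => if w.2 = 0 then T₀ w.1 else T w.1 := by
  rintro d ⟨i, j⟩ hm
  obtain rfl := mem_desired_equivalentUnicast.1 hm
  induction j using Fin.cases with
  | zero =>
    refine (h₀ i).mono (by simp) (iSup₂_le ?_)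
    rintro ⟨m, j⟩ ⟨hne, hw⟩
    obtain rfl : m = i := by simpa [mem_antidotes_equivalentUnicast_zero] using hw
    have : j ≠ 0 := by rintro rfl; exact hne rfl
    simp [this]
  | succ l =>
    refine (hT (E.dest i l) i ((E.mem_desired_iff _ _).2 ⟨l, rfl⟩)).mono (by simp) (iSup₂_le ?_)
    rintro ⟨m, j⟩ ⟨hne, hw⟩
    simp only [mem_antidotes_equivalentUnicast_succ, not_or, not_and, not_not] at hw
    obtain ⟨⟨ha, hj⟩, himp⟩ := hw
    have hmi : m ≠ i := by rintro rfl; exact hne (by rw [himp rfl])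
    simp only [hj, if_false]
    exact le_iSup₂_of_le (f := fun i _ => T i) m ⟨hmi, ha⟩ le_rfl

theorem LinearlyAchievable.equivalentUnicast {M K L : ℕ} {P : IndexCodingProblem (Fin M) (Fin K)}
    (hP : ∀ m, ∃ k, m ∈ P.desired k) (E : P.Listing L) {R : Fin M → ℝ} (hR : ∀ m, 0 ≤ R m)
    (h : P.LinearlyAchievable R) :
    (P.equivalentUnicast E).LinearlyAchievable (unicastRates L R) := by
  refine linearlyAchievable_of_resolves fun δ hδ => ?_
  obtain ⟨F, _, _, n, T, hn, hT, hd⟩ := h.exists_resolves hP hδ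
  -- The spaces are cut down to dimension about (R m - δ)tn, as larger ones would leave too small a
  -- complement. With t > 1/δ, rounding to an integer costs at most δtn.
  obtain ⟨t, ht⟩ := exists_nat_gt (1 / δ)
  have ht0 : 0 < t := by
    have : (0 : ℝ) < t := lt_trans (by positivity) ht
    exact_mod_cast this
  have : Nonempty (Fin t) := ⟨⟨0, ht0⟩⟩
  have : Nonempty (Fin n) := ⟨⟨0, hn⟩⟩
  have hfin : finrank F (Fin t → Fin n → F) = t * n := by simp [finrank_pi_fintype]
  have hn1 : (1 : ℝ) ≤ n := by exact_mod_cast hn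
  have hbig : 1 ≤ (t * n : ℝ) * δ := by
    have h1 : 1 < t * δ := by rwa [div_lt_iff₀ hδ] at ht
    nlinarith
  have hsub : ∀ m, ∃ T' : Submodule F (Fin t → Fin n → F),
      T' ≤ Submodule.pi Set.univ (fun _ => T m) ∧
        finrank F T' = ⌈(R m - δ) * (t * n : ℝ)⌉₊ := by
    intro m
    have hle : ⌈(R m - δ) * (t * n : ℝ)⌉₊ ≤
        finrank F (Submodule.pi (Set.univ : Set (Fin t)) fun _ => T m) := by
      rw [finrank_pi_const, Nat.ceil_le]
      push_cast
      nlinarith [hd m, (Nat.cast_nonneg t : (0 : ℝ) ≤ t)]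
    exact exists_le_finrank_eq hle
  choose T' hT' hd' using hsub
  choose T₀ h₀ using fun m => (T' m).exists_isCompl
  refine ⟨F, inferInstance, inferInstance, Fin t → Fin n → F, inferInstance, inferInstance,
    inferInstance, inferInstance,
    _, ((hT.pi t).mono hT').equivalentUnicast (E := E) (T₀ := T₀) fun i => (h₀ i).disjoint.symm, ?_⟩
  rintro ⟨i, j⟩
  rw [hfin]
  push_cast
  by_cases hj : j = 0
  · dsimp only [unicastRates]
    rw [if_pos hj, if_pos hj]
    have hsum := Submodule.finrank_add_eq_of_isCompl (h₀ i)
    rw [hfin, hd'] at hsum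
    have hsum' : (⌈(R i - δ) * (t * n : ℝ)⌉₊ : ℝ) + finrank F (T₀ i) = t * n := by
      exact_mod_cast hsum
    have hceil : (⌈(R i - δ) * (t * n : ℝ)⌉₊ : ℝ) ≤ (R i + δ) * (t * n) := by
      rcases le_total (R i - δ) 0 with hneg | hpos
      · have : ⌈(R i - δ) * (t * n : ℝ)⌉₊ = 0 :=
          Nat.ceil_eq_zero.2 (mul_nonpos_of_nonpos_of_nonneg hneg (by positivity))
        rw [this]
        have := hR i
        simp only [Nat.cast_zero]
        positivity
      · have := (Nat.ceil_lt_add_one (a := (R i - δ) * (t * n : ℝ)) (by positivity)).le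
        linarith
    linarith
  · dsimp only [unicastRates]
    rw [if_neg hj, if_neg hj, hd']
    exact Nat.le_ceil _

/-- Codimensions inside `A` add up under intersection. Including `A` itself in the intersection
makes the case L = 0 true. -/
theorem finrank_iInf_fin {F V : Type} [Field F] [AddCommGroup V] [Module F V]
    [FiniteDimensional F V] (A : Submodule F V) (x : ℝ) :
    ∀ (L : ℕ) (T : Fin L → Submodule F V), (∀ l, T l ≤ A) →
      (∀ l, finrank F A - x ≤ finrank F (T l)) →
      finrank F A - L * x ≤ finrank F (A ⊓ ⨅ l, T l : Submodule F V) := by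
  intro L
  induction L with
  | zero => intro T _ _; rw [iInf_of_empty, inf_top_eq]; simp
  | succ L ih =>
    intro T hA hT
    have h1 := ih (fun l => T l.succ) (fun l => hA _) (fun l => hT _)
    have h2 : A ⊓ ⨅ l, T l = T 0 ⊓ (A ⊓ ⨅ l : Fin L, T l.succ) := by
      refine le_antisymm (le_inf (inf_le_right.trans (iInf_le _ 0))
        (inf_le_inf_left _ (le_iInf fun l => iInf_le _ l.succ)))
        (le_inf (inf_le_right.trans inf_le_left) (le_iInf (Fin.cases inf_le_left fun l => ?_)))
      exact inf_le_right.trans (inf_le_right.trans (iInf_le _ l))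
    have h3 := Submodule.finrank_sup_add_finrank_inf_eq (T 0) (A ⊓ ⨅ l : Fin L, T l.succ)
    have h4 : finrank F (T 0 ⊔ (A ⊓ ⨅ l : Fin L, T l.succ) : Submodule F V) ≤ finrank F A :=
      Submodule.finrank_mono (sup_le (hA 0) inf_le_left)
    have h5 := hT 0
    rw [← h2] at h3
    have h3' : (finrank F (T 0 ⊔ (A ⊓ ⨅ l : Fin L, T l.succ) : Submodule F V) : ℝ) +
        finrank F (A ⊓ ⨅ l, T l : Submodule F V) = finrank F (T 0) +
        finrank F (A ⊓ ⨅ l : Fin L, T l.succ : Submodule F V) := by exact_mod_cast h3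
    have h4' : (finrank F (T 0 ⊔ (A ⊓ ⨅ l : Fin L, T l.succ) : Submodule F V) : ℝ) ≤
        finrank F A := by exact_mod_cast h4
    push_cast
    linarith

theorem LinearlyAchievable.of_equivalentUnicast {M K L : ℕ}
    {P : IndexCodingProblem (Fin M) (Fin K)} (hP : ∀ m, ∃ k, m ∈ P.desired k) {E : P.Listing L}
    {R : Fin M → ℝ} (h : (P.equivalentUnicast E).LinearlyAchievable (unicastRates L R)) :
    P.LinearlyAchievable R := by
  refine linearlyAchievable_of_resolves fun δ hδ => ?_
  -- Each space has codimension at most 2ηn in the span of its row, so intersecting L of them loses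
  -- 2Lηn; one further ηn is lost because the span is only known to have dimension at least (R i -
  -- η)n.
  have hη : 0 < δ / (2 * L + 1) := by positivity
  set η := δ / (2 * L + 1) with hη_def
  have hδη : (2 * L + 1) * η = δ := by rw [hη_def]; field_simp
  obtain ⟨F, _, _, n, T, hn, hT, hd⟩ := h.exists_resolves (fun m => ⟨m, rfl⟩) hη
  have : Nonempty (Fin n) := ⟨⟨0, hn⟩⟩
  refine ⟨F, inferInstance, inferInstance, Fin n → F, inferInstance, inferInstance,
    inferInstance, inferInstance,
    fun i => ⨅ l : Fin L, T (i, l.succ), ?_, ?_⟩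
  · intro k m hm
    obtain ⟨l, rfl⟩ := (E.mem_desired_iff _ _).1 hm
    refine (hT (m, l.succ) (m, l.succ) rfl).mono (iInf_le _ l) (iSup₂_le fun i hi => ?_)
    refine (iInf_le _ l).trans
      (le_iSup₂_of_le (f := fun w _ => T w) (i, l.succ) ⟨?_, ?_⟩ le_rfl)
    · simpa using hi.1
    · simp [mem_antidotes_equivalentUnicast_succ, hi.1, hi.2]
  · intro i
    -- This gives L > 0; an empty intersection would be the whole space and not lie in `A`.
    obtain ⟨k, hk⟩ := hP i
    obtain ⟨l₀, -⟩ := (E.mem_desired_iff _ _).1 hk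
    set A := ⨆ l : Fin L, T (i, l.succ) with hA
    have hdisj : Disjoint (T (i, 0)) A := by
      refine (hT (i, 0) (i, 0) rfl).mono_right (iSup_le fun l => ?_)
      exact le_iSup₂_of_le (f := fun w _ => T w) (i, l.succ)
        ⟨by simp, by simp [mem_antidotes_equivalentUnicast_zero]⟩ le_rfl
    have hsum := Submodule.finrank_add_finrank_le_of_disjoint hdisj
    rw [finrank_fin_fun] at hsum
    have hsum' : (finrank F (T (i, 0)) : ℝ) + finrank F A ≤ n := by exact_mod_cast hsum
    have h0 := hd (i, 0)
    simp only [unicastRates, if_true] at h0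
    have hl : ∀ l : Fin L, (R i - η) * n ≤ finrank F (T (i, l.succ)) := fun l => by
      simpa [unicastRates] using hd (i, l.succ)
    have hTA : ∀ l : Fin L, T (i, l.succ) ≤ A := fun l => le_iSup (fun l : Fin L => T (i, l.succ)) l
    have hinf := finrank_iInf_fin A (2 * η * n) L (fun l => T (i, l.succ)) hTA
      fun l => by linarith [hl l]
    have hle : (⨅ l : Fin L, T (i, l.succ)) ≤ A := (iInf_le _ l₀).trans (hTA l₀)
    rw [inf_eq_right.2 hle] at hinf
    have hAbig : (finrank F (T (i, l₀.succ)) : ℝ) ≤ finrank F A := by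
      exact_mod_cast Submodule.finrank_mono (hTA l₀)
    have := hl l₀
    rw [finrank_fin_fun, ← hδη]
    linarith

/-! ### Averaging, and schemes as separating encoders -/

open Finset in
/-- If each `w` is bad for a fraction at most `η` of the choices `ω`, then some choice `ω` makes a
fraction at most `η` of the `w` bad. -/
theorem exists_card_bad_le {Ω W : Type} [Fintype Ω] [Fintype W] [Nonempty Ω]
    (bad : Ω → W → Prop) [∀ ω w, Decidable (bad ω w)] (η : ℝ)
    (h : ∀ w, ((univ.filter fun ω => bad ω w).card : ℝ) ≤ η * Fintype.card Ω) :
    ∃ ω, ((univ.filter fun w => bad ω w).card : ℝ) ≤ η * Fintype.card W := by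
  have hsum : ∑ ω : Ω, ((univ.filter fun w => bad ω w).card : ℝ) ≤
      ∑ _ω : Ω, η * Fintype.card W := by
    have hswap := Finset.sum_card_bipartiteAbove_eq_sum_card_bipartiteBelow bad
      (s := (univ : Finset Ω)) (t := (univ : Finset W))
    simp only [bipartiteAbove, bipartiteBelow] at hswap
    calc ∑ ω : Ω, ((univ.filter fun w => bad ω w).card : ℝ)
        = ∑ w : W, ((univ.filter fun ω => bad ω w).card : ℝ) := by exact_mod_cast hswap
      _ ≤ ∑ _w : W, η * Fintype.card Ω := sum_le_sum fun w _ => h w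
      _ = ∑ _ω : Ω, η * Fintype.card W := by
          simp only [sum_const, card_univ, nsmul_eq_mul]; ring
  obtain ⟨ω, -, hω⟩ := exists_le_of_sum_le univ_nonempty hsum
  exact ⟨ω, hω⟩

/-- On the message tuples in `G`, the output of the encoder `f` and the antidotes of a destination
determine the messages desired by it. -/
def SeparatesOn {ι κ : Type} (P : IndexCodingProblem ι κ) {X : ι → Type} {Y : Type}
    (f : (∀ m, X m) → Y) (G : Set (∀ m, X m)) : Prop :=
  ∀ w ∈ G, ∀ w' ∈ G, ∀ k m, m ∈ P.desired k → f w = f w' →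
    (∀ a ∈ P.antidotes k, w a = w' a) → w m = w' m

theorem Scheme.separatesOn {ι κ : Type} {P : IndexCodingProblem ι κ} {S : Type} [Fintype S] {n : ℕ}
    {R : ι → ℝ} (C : P.Scheme S n R) : P.SeparatesOn C.encode {w | C.Correct w} := by
  intro w hw w' hw' k m hm hf ha
  rw [← hw k m hm, ← hw' k m hm, hf]
  congr 1
  funext a
  exact ha a a.2

theorem SeparatesOn.exists_scheme {ι κ : Type} [Fintype ι] {P : IndexCodingProblem ι κ}
    {N : ι → ℕ} {Y : Type} [Fintype Y] {f : (∀ m, Fin (N m)) → Y} {G : Set (∀ m, Fin (N m))}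
    (h : P.SeparatesOn f G) (hY : 1 < Fintype.card Y) (hN : ∀ m, 0 < N m) :
    ∃ C : P.Scheme Y 1 fun m => Real.logb (Fintype.card Y) (N m),
      C.errorProb ≤ 1 - (G.ncard : ℝ) / ((∏ m, N m : ℕ) : ℝ) := by
  classical
  have hY0 : (0 : ℝ) < Fintype.card Y := by exact_mod_cast zero_lt_one.trans hY
  have hY1 : (Fintype.card Y : ℝ) ≠ 1 := by exact_mod_cast hY.ne'
  let C : P.Scheme Y 1 fun m => Real.logb (Fintype.card Y) (N m) :=
    { one_lt_card := hY
      n_pos := one_pos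
      size := N
      size_eq := fun m => by
        rw [Nat.cast_one, one_mul, Real.rpow_logb hY0 hY1 (by exact_mod_cast hN m)]
      encode := fun w _ => f w
      decode := fun k m _ y side =>
        -- Any tuple of `G` consistent with the observations will do, since separation makes its
        -- `m`-th entry unique. The default is never used when the true tuple lies in `G`.
        if hw : ∃ w ∈ G, f w = y 0 ∧ ∀ a : P.antidotes k, w a = side a then hw.choose m
        else ⟨0, hN m⟩ }
  refine ⟨C, ?_⟩
  have hG : G ⊆ {w | C.Correct w} := by
    intro w hw k m hm
    have hex : ∃ w' ∈ G, f w' = f w ∧ ∀ a : P.antidotes k, w' a = w a :=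
      ⟨w, hw, rfl, fun _ => rfl⟩
    have hdec : C.decode k m hm (C.encode w) (fun a => w a) = hex.choose m := dif_pos hex
    rw [hdec]
    obtain ⟨hG', hf, ha⟩ := hex.choose_spec
    exact h _ hG' _ hw k m hm hf fun a ha' => ha ⟨a, ha'⟩
  have hle : (G.ncard : ℝ) ≤ ({w | C.Correct w}.ncard : ℝ) := by
    exact_mod_cast Set.ncard_le_ncard hG (Set.toFinite _)
  exact sub_le_sub_left (div_le_div_of_nonneg_right hle (Nat.cast_nonneg _)) 1

theorem achievable_of_separatesOn {ι κ : Type} [Fintype ι] {P : IndexCodingProblem ι κ} {R : ι → ℝ}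
    (h : ∀ ε δ : ℝ, 0 < ε → 0 < δ → ∃ (q : ℕ) (N : ι → ℕ) (f : (∀ m, Fin (N m)) → Fin q)
      (G : Set (∀ m, Fin (N m))), 1 < q ∧ (∀ m, 0 < N m) ∧
        (∀ m, (q : ℝ) ^ (R m - δ) ≤ N m) ∧ P.SeparatesOn f G ∧
        (1 - ε) * ((∏ m, N m : ℕ) : ℝ) ≤ G.ncard) :
    P.Achievable R := by
  intro ε δ hε hδ
  obtain ⟨q, N, f, G, hq, hN, hR, hG, hcard⟩ := h ε δ hε hδ
  obtain ⟨C, hC⟩ := hG.exists_scheme (by simpa using hq) hN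
  refine ⟨Fin q, inferInstance, 1, _, C, fun m => ?_, hC.trans ?_⟩
  · rw [Fintype.card_fin, Real.le_logb_iff_rpow_le (by exact_mod_cast hq)
      (by exact_mod_cast hN m)]
    exact hR m
  · have hpos : (0 : ℝ) < ((∏ m, N m : ℕ) : ℝ) := by
      exact_mod_cast Finset.prod_pos fun m _ => hN m
    have := (le_div_iff₀ hpos).2 hcard
    linarith

theorem SeparatesOn.comp_equiv {ι κ : Type} {P : IndexCodingProblem ι κ} {X X' : ι → Type}
    {Y Y' : Type} {f : (∀ m, X m) → Y} {G : Set (∀ m, X m)} (h : P.SeparatesOn f G)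
    (e : ∀ m, X' m ≃ X m) {φ : Y → Y'} (hφ : Function.Injective φ) :
    P.SeparatesOn (fun w => φ (f fun m => e m (w m))) {w | (fun m => e m (w m)) ∈ G} :=
  fun _ hw _ hw' k m hm hf ha => (e m).injective
    (h _ hw _ hw' k m hm (hφ hf) fun a h' => congrArg (e a) (ha a h'))

/-- Using the channel `t` times as often. -/
theorem SeparatesOn.pow {ι κ : Type} {P : IndexCodingProblem ι κ} {X : ι → Type}
    {Y : Type} {f : (∀ m, X m) → Y} {G : Set (∀ m, X m)} (h : P.SeparatesOn f G) (t : ℕ) :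
    P.SeparatesOn (X := fun m => Fin t → X m) (fun w s => f fun m => w m s)
      {w | ∀ s, (fun m => w m s) ∈ G} :=
  fun _ hw _ hw' k m hm hf ha => funext fun s =>
    h _ (hw s) _ (hw' s) k m hm (congrFun hf s) fun a h' => congrFun (ha a h') s

theorem ncard_pow {ι : Type} {X : ι → Type} (G : Set (∀ m, X m)) (t : ℕ) :
    {w : ∀ m, Fin t → X m | ∀ s, (fun m => w m s) ∈ G}.ncard = G.ncard ^ t := by
  let e : {w : ∀ m, Fin t → X m | ∀ s, (fun m => w m s) ∈ G} ≃ (Fin t → G) :=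
    { toFun := fun w s => ⟨fun m => w.1 m s, w.2 s⟩
      invFun := fun g => ⟨fun m s => (g s).1 m, fun s => (g s).2⟩
      left_inv := fun _ => rfl
      right_inv := fun _ => rfl }
  rw [← Nat.card_coe_set_eq, Nat.card_congr e, Nat.card_fun, Nat.card_coe_set_eq, Nat.card_fin]

theorem ncard_preimage_piCongrRight {ι : Type} {X X' : ι → Type} (e : ∀ m, X' m ≃ X m)
    (G : Set (∀ m, X m)) : {w : ∀ m, X' m | (fun m => e m (w m)) ∈ G}.ncard = G.ncard :=
  Set.ncard_preimage_of_injective_subset_range (f := Equiv.piCongrRight e)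
    (Equiv.injective _) (by simp)

/-- A scheme for given ε and δ may have a small output alphabet, so it is repeated and a whole block
is regarded as one symbol. -/
theorem Achievable.exists_separatesOn {ι κ : Type} [Fintype ι] {P : IndexCodingProblem ι κ}
    {R : ι → ℝ} (h : P.Achievable R) {ε δ : ℝ} (hε : 0 < ε) (hδ : 0 < δ) (q₀ : ℕ) :
    ∃ (q : ℕ) (N : ι → ℕ) (f : (∀ m, Fin (N m)) → Fin q) (G : Set (∀ m, Fin (N m))),
      q₀ ≤ q ∧ 1 < q ∧ (∀ m, 0 < N m) ∧ (∀ m, (q : ℝ) ^ (R m - δ) ≤ N m) ∧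
      P.SeparatesOn f G ∧ (1 - ε) * ((∏ m, N m : ℕ) : ℝ) ≤ G.ncard := by
  classical
  -- The number of repetitions is fixed before the scheme is chosen, so the error `ε'` of one use
  -- may depend on it; Bernoulli's inequality then bounds the error of all t uses by ε.
  set t := q₀ + 1 with ht
  obtain ⟨ε', hε', hε'1, hεt⟩ : ∃ ε' : ℝ, 0 < ε' ∧ ε' ≤ 1 ∧ t * ε' ≤ ε := by
    refine ⟨min 1 (ε / t), by positivity, min_le_left _ _, ?_⟩
    calc (t : ℝ) * min 1 (ε / t) ≤ t * (ε / t) := by gcongr; exact min_le_right _ _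
      _ = ε := mul_div_cancel₀ _ (by positivity)
  obtain ⟨S, _, n, R', C, hR, hC⟩ := h ε' δ hε' hδ
  set Q := Fintype.card (Fin n → S) with hQ
  have hQS : Q = Fintype.card S ^ n := by simp [hQ]
  have hQ1 : 1 < Q := by rw [hQS]; exact Nat.one_lt_pow C.n_pos.ne' C.one_lt_card
  have hSpos : (0 : ℝ) < Fintype.card S := by exact_mod_cast zero_lt_one.trans C.one_lt_card
  have hsize : ∀ m, 0 < C.size m := fun m => by
    have : (0 : ℝ) < C.size m := by rw [C.size_eq]; positivity
    exact_mod_cast this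
  have hcard : Fintype.card (Fin t → Fin n → S) = Q ^ t := by simp [hQ]
  let φ := Fintype.equivFinOfCardEq hcard
  let e : ∀ m, Fin (C.size m ^ t) ≃ (Fin t → Fin (C.size m)) := fun m => finFunctionFinEquiv.symm
  refine ⟨Q ^ t, fun m => C.size m ^ t, _, _, ?_, Nat.one_lt_pow (by omega) hQ1,
    fun m => pow_pos (hsize m) t, fun m => ?_, (C.separatesOn.pow t).comp_equiv e φ.injective, ?_⟩
  · calc q₀ ≤ t := by omega
      _ ≤ Q ^ t := (Nat.lt_pow_self hQ1).le
  · have h1 : ((Q : ℕ) : ℝ) ^ (R m - δ) ≤ C.size m := by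
      rw [C.size_eq, hQS, Nat.cast_pow, ← Real.rpow_natCast, ← Real.rpow_mul hSpos.le]
      refine Real.rpow_le_rpow_of_exponent_le (by exact_mod_cast C.one_lt_card.le) ?_
      exact mul_le_mul_of_nonneg_left (hR m) n.cast_nonneg
    rw [Nat.cast_pow, Nat.cast_pow, ← Real.rpow_natCast, ← Real.rpow_mul (Nat.cast_nonneg _),
      mul_comm, Real.rpow_mul (Nat.cast_nonneg _), Real.rpow_natCast]
    exact pow_le_pow_left₀ (by positivity) h1 t
  · rw [ncard_preimage_piCongrRight, ncard_pow, Finset.prod_pow, Nat.cast_pow, Nat.cast_pow]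
    have hpos : (0 : ℝ) < ((∏ m, C.size m : ℕ) : ℝ) := by
      exact_mod_cast Finset.prod_pos fun m _ => hsize m
    have hG : (1 - ε') * ((∏ m, C.size m : ℕ) : ℝ) ≤ {w | C.Correct w}.ncard := by
      rw [← le_div_iff₀ hpos]
      unfold Scheme.errorProb at hC
      linarith
    have hbern : 1 - ε ≤ (1 - ε') ^ t := by
      have := one_add_mul_le_pow (a := -ε') (by linarith) t
      rw [← sub_eq_add_neg] at this
      linarith
    calc (1 - ε) * ((∏ m, C.size m : ℕ) : ℝ) ^ t
        ≤ (1 - ε') ^ t * ((∏ m, C.size m : ℕ) : ℝ) ^ t := by gcongr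
      _ = ((1 - ε') * ((∏ m, C.size m : ℕ) : ℝ)) ^ t := (mul_pow _ _ _).symm
      _ ≤ _ := pow_le_pow_left₀ (mul_nonneg (by linarith) hpos.le) hG t

/-! ### Achievable rates of desired messages are at most one -/

theorem exists_le_rpow {δ : ℝ} (hδ : 0 < δ) (c : ℝ) : ∃ q₀ : ℕ, ∀ q ≥ q₀, c ≤ (q : ℝ) ^ δ :=
  Filter.eventually_atTop.1
    (((tendsto_rpow_atTop hδ).comp tendsto_natCast_atTop_atTop).eventually_ge_atTop c)

/-- Overwriting coordinate `m` of a good tuple loses nothing once the encoder output is recorded: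
`m` is not an antidote of `k`, so the output and the other coordinates recover it. -/
theorem SeparatesOn.ncard_mul_le {ι κ : Type} [Fintype ι] {P : IndexCodingProblem ι κ} {q : ℕ}
    {N : ι → ℕ} {f : (∀ m, Fin (N m)) → Fin q} {G : Set (∀ m, Fin (N m))}
    (h : P.SeparatesOn f G) {m : ι} {k : κ} (hm : m ∈ P.desired k) :
    G.ncard * N m ≤ q * ∏ i, N i := by
  classical
  let F : G × Fin (N m) → Fin q × ∀ i, Fin (N i) := fun p =>
    (f p.1, Function.update (p.1 : ∀ i, Fin (N i)) m p.2)
  have hF : Function.Injective F := by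
    rintro ⟨⟨w, hw⟩, x⟩ ⟨⟨w', hw'⟩, x'⟩ hww
    obtain ⟨h1, h2⟩ := Prod.ext_iff.1 hww
    have hx : x = x' := by simpa [F] using congrFun h2 m
    have hne : ∀ i, i ≠ m → w i = w' i := fun i hi => by simpa [F, hi] using congrFun h2 i
    have hwm : w m = w' m := h w hw w' hw' k m hm h1 fun a ha =>
      hne a fun ham => Set.disjoint_left.1 (P.disjoint k) hm (ham ▸ ha)
    have : w = w' := funext fun i => by
      by_cases hi : i = m
      · exact hi ▸ hwm
      · exact hne i hi
    subst this hx
    rfl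
  have := Nat.card_le_card_of_injective F hF
  simpa only [Nat.card_prod, Nat.card_coe_set_eq, Nat.card_pi, Nat.card_fin] using this

theorem Achievable.le_one {ι κ : Type} [Fintype ι] {P : IndexCodingProblem ι κ}
    {R : ι → ℝ} (h : P.Achievable R) {m : ι} {k : κ} (hm : m ∈ P.desired k) : R m ≤ 1 := by
  by_contra! hR
  obtain ⟨δ, hδ, hRδ⟩ : ∃ δ : ℝ, 0 < δ ∧ R m = 1 + 2 * δ := ⟨(R m - 1) / 2, by linarith, by ring⟩
  -- Any constant above 2 contradicts the counting bound, as `G` contains at least half of all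
  -- tuples.
  obtain ⟨q₀, hq₀⟩ := exists_le_rpow hδ 3
  obtain ⟨q, N, f, G, hq, hq1, hN, hRN, hG, hcard⟩ :=
    h.exists_separatesOn (ε := 1 / 2) (by norm_num) hδ q₀
  have hpos : (0 : ℝ) < ((∏ m, N m : ℕ) : ℝ) := by
    exact_mod_cast Finset.prod_pos fun m _ => hN m
  have hle : (G.ncard : ℝ) * N m ≤ q * ((∏ m, N m : ℕ) : ℝ) := by
    exact_mod_cast hG.ncard_mul_le hm
  have hqpos : (0 : ℝ) < q := by exact_mod_cast zero_lt_one.trans hq1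
  have hNm : (q : ℝ) * 3 ≤ N m := by
    refine le_trans ?_ (hRN m)
    have : R m - δ = 1 + δ := by rw [hRδ]; ring
    rw [this, Real.rpow_add hqpos, Real.rpow_one]
    exact mul_le_mul_of_nonneg_left (hq₀ q hq) hqpos.le
  have h1 : (1 - 1 / 2) * ((∏ m, N m : ℕ) : ℝ) * (q * 3) ≤ G.ncard * N m :=
    mul_le_mul hcard hNm (by positivity) (by positivity)
  nlinarith [mul_pos hqpos hpos]

/-! ### Random coding for the unicast problem -/

open Finset in
/-- A random shift `a` of the messages and a random codebook `g` do not spoil the correctness of the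
encoder `f` by more than the number of competing codewords divided by the size of the output. -/
theorem exists_shift_codebook {ι W Y : Type} [Fintype ι] [DecidableEq ι] [Fintype W] [Fintype Y]
    [AddCommGroup Y] {X X' B : ι → Type} [∀ i, Fintype (X i)] [∀ i, AddCommGroup (X i)]
    [∀ i, Fintype (X' i)] [∀ i, Fintype (B i)] (f : (∀ i, X i) → Y)
    (G : Set (∀ i, X i)) (e : ∀ i, X' i → X i) (aux : W → ∀ i, B i) (σ : W → ∀ i, X' i) {η : ℝ}
    (hG : (1 - η) * Fintype.card (∀ i, X i) ≤ G.ncard) :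
    ∃ (a : ∀ i, X i) (g : (Σ i, B i) → Y),
      (1 - (η + ∑ i, (Fintype.card (B i) * Fintype.card (X' i) : ℝ) / Fintype.card Y)) *
          Fintype.card W ≤
        {w | (fun i => a i + e i (σ w i)) ∈ G ∧ ∀ i b, b ≠ aux w i → ∀ x : X' i,
          f (Function.update (fun i => a i + e i (σ w i)) i (a i + e i x)) + g ⟨i, b⟩ ≠
            f (fun i => a i + e i (σ w i)) + g ⟨i, aux w i⟩}.ncard := by
  classical
  let Ω := (∀ i, X i) × ((Σ i, B i) → Y)
  let s : Ω → W → ∀ i, X i := fun ω w i => ω.1 i + e i (σ w i)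
  let bad : Ω → W → Prop := fun ω w => s ω w ∉ G ∨ ∃ i b, b ≠ aux w i ∧ ∃ x : X' i,
    f (Function.update (s ω w) i (ω.1 i + e i x)) + ω.2 ⟨i, b⟩ = f (s ω w) + ω.2 ⟨i, aux w i⟩
  have hYpos : (0 : ℝ) < Fintype.card Y := by exact_mod_cast Fintype.card_pos
  -- For fixed `w`, translation is a bijection, so the shifted tuple is uniform over all tuples.
  have hshift : ∀ w, ((univ.filter fun ω : Ω => s ω w ∉ G).card : ℝ) ≤ η * Fintype.card Ω := by
    intro w
    have heq : (univ.filter fun ω : Ω => s ω w ∉ G).card =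
        (univ.filter fun x : ∀ i, X i => x ∉ G).card * Fintype.card ((Σ i, B i) → Y) := by
      rw [← card_univ, ← card_product]
      refine card_equiv ((Equiv.addRight fun i => e i (σ w i)).prodCongr (Equiv.refl _)) fun ω => ?_
      simp only [mem_filter, mem_univ, true_and, mem_product, and_true]
      rfl
    have hcompl : ((univ.filter fun x : ∀ i, X i => x ∉ G).card : ℝ) ≤
        η * Fintype.card (∀ i, X i) := by
      have h1 := card_filter_add_card_filter_not (s := (univ : Finset (∀ i, X i))) (· ∈ G)
      have h2 : G.ncard = (univ.filter fun x : ∀ i, X i => x ∈ G).card := by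
        rw [← Set.ncard_coe_finset]
        simp
      rw [h2] at hG
      have h3 : ((univ.filter fun x : ∀ i, X i => x ∈ G).card : ℝ) +
          (univ.filter fun x : ∀ i, X i => x ∉ G).card = Fintype.card (∀ i, X i) := by
        exact_mod_cast h1
      linarith
    rw [heq, Fintype.card_prod]
    push_cast
    rw [← mul_assoc]
    gcongr
  have hcollide : ∀ w i b, b ≠ aux w i → ∀ x : X' i,
      ((univ.filter fun ω : Ω => f (Function.update (s ω w) i (ω.1 i + e i x)) + ω.2 ⟨i, b⟩ =
        f (s ω w) + ω.2 ⟨i, aux w i⟩).card : ℝ) ≤ Fintype.card Ω / Fintype.card Y := by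
    intro w i b hb x
    rw [le_div_iff₀ hYpos]
    have : (univ.filter fun ω : Ω => f (Function.update (s ω w) i (ω.1 i + e i x)) + ω.2 ⟨i, b⟩ =
        f (s ω w) + ω.2 ⟨i, aux w i⟩).card * Fintype.card Y ≤ Fintype.card Ω := by
      rw [← card_univ (α := Y), ← card_product, ← card_univ (α := Ω)]
      -- A collision determines `g ⟨i, b⟩` from the rest of the choice, so that entry can be
      -- overwritten by `y` injectively. Here `b ≠ aux w i` ensures that the other codeword is
      -- untouched.
      refine card_le_card_of_injOn (fun p => (p.1.1, Function.update p.1.2 ⟨i, b⟩ p.2))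
        (fun _ _ => mem_coe.2 (mem_univ _)) ?_
      rintro ⟨⟨a, g⟩, y⟩ hp ⟨⟨a', g'⟩, y'⟩ hp' heq
      simp only [coe_product, Set.mem_prod, mem_coe, mem_filter, mem_univ, true_and, and_true]
        at hp hp'
      obtain ⟨ha, hg⟩ := Prod.ext_iff.1 heq
      obtain rfl : a = a' := ha
      obtain rfl : y = y' := by simpa using congrFun hg ⟨i, b⟩
      have hne : ∀ v, v ≠ ⟨i, b⟩ → g v = g' v := fun v hv => by
        simpa [Function.update_of_ne hv] using congrFun hg v
      have haux : g ⟨i, aux w i⟩ = g' ⟨i, aux w i⟩ := hne _ fun h => hb (by simpa using h.symm)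
      have hgg : g = g' := funext fun v => by
        by_cases hv : v = ⟨i, b⟩
        · subst hv
          rw [haux, ← hp'] at hp
          exact add_left_cancel hp
        · exact hne v hv
      rw [hgg]
    exact_mod_cast this
  have hbad : ∀ w, ((univ.filter fun ω : Ω => bad ω w).card : ℝ) ≤
      (η + ∑ i, (Fintype.card (B i) * Fintype.card (X' i) : ℝ) / Fintype.card Y) *
        Fintype.card Ω := by
    intro w
    let T : (i : ι) → B i → X' i → Finset Ω := fun i b x => if b = aux w i then ∅ else
      univ.filter fun ω : Ω => f (Function.update (s ω w) i (ω.1 i + e i x)) + ω.2 ⟨i, b⟩ =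
        f (s ω w) + ω.2 ⟨i, aux w i⟩
    have hT : ∀ i b x, ((T i b x).card : ℝ) ≤ Fintype.card Ω / Fintype.card Y := by
      intro i b x
      by_cases hb : b = aux w i
      · simp only [T, if_pos hb, card_empty, Nat.cast_zero]
        positivity
      · simp only [T, if_neg hb]
        exact hcollide w i b hb x
    have hsub : (univ.filter fun ω : Ω => bad ω w) ⊆ (univ.filter fun ω : Ω => s ω w ∉ G) ∪
        univ.biUnion fun i => univ.biUnion fun b => univ.biUnion fun x => T i b x := by
      intro ω hω
      rcases (mem_filter.1 hω).2 with h | ⟨i, b, hb, x, hx⟩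
      · exact mem_union_left _ (mem_filter.2 ⟨mem_univ _, h⟩)
      · refine mem_union_right _ (mem_biUnion.2 ⟨i, mem_univ _, mem_biUnion.2 ⟨b, mem_univ _,
          mem_biUnion.2 ⟨x, mem_univ _, ?_⟩⟩⟩)
        simp only [T, if_neg hb]
        exact mem_filter.2 ⟨mem_univ _, hx⟩
    have hunion : (univ.filter fun ω : Ω => bad ω w).card ≤
        (univ.filter fun ω : Ω => s ω w ∉ G).card + ∑ i, ∑ b, ∑ x, (T i b x).card :=
      (card_le_card hsub).trans <| (card_union_le _ _).trans <| by
        gcongr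
        exact card_biUnion_le.trans <| sum_le_sum fun i _ => card_biUnion_le.trans <|
          sum_le_sum fun b _ => card_biUnion_le
    calc ((univ.filter fun ω : Ω => bad ω w).card : ℝ)
        ≤ (univ.filter fun ω : Ω => s ω w ∉ G).card + ∑ i, ∑ b, ∑ x, ((T i b x).card : ℝ) := by
          exact_mod_cast hunion
      _ ≤ η * Fintype.card Ω +
          ∑ i, ∑ _b : B i, ∑ _x : X' i, (Fintype.card Ω : ℝ) / Fintype.card Y :=
          add_le_add (hshift w) (sum_le_sum fun i _ => sum_le_sum fun b _ => sum_le_sum fun x _ =>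
            hT i b x)
      _ = _ := by
          rw [add_mul, sum_mul]
          congr 1
          refine sum_congr rfl fun i _ => ?_
          simp only [sum_const, card_univ, nsmul_eq_mul]
          ring
  obtain ⟨⟨a, g⟩, hag⟩ := exists_card_bad_le bad _ hbad
  refine ⟨a, g, ?_⟩
  have h1 := card_filter_add_card_filter_not (s := (univ : Finset W)) (bad (a, g))
  have h3 : ((univ.filter fun w => bad (a, g) w).card : ℝ) +
      (univ.filter fun w => ¬ bad (a, g) w).card = Fintype.card W := by
    exact_mod_cast h1
  have h2 : (univ.filter fun w => ¬ bad (a, g) w).card ≤ _ :=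
    (Set.ncard_coe_finset _).ge.trans (Set.ncard_le_ncard
      (t := {w | (fun i => a i + e i (σ w i)) ∈ G ∧ ∀ i b, b ≠ aux w i → ∀ x : X' i,
        f (Function.update (fun i => a i + e i (σ w i)) i (a i + e i x)) + g ⟨i, b⟩ ≠
          f (fun i => a i + e i (σ w i)) + g ⟨i, aux w i⟩}) (fun w hw => by
      have hw' : ¬ bad (a, g) w := (mem_filter.1 (mem_coe.1 hw)).2
      simp only [bad, not_or, not_not] at hw'
      exact ⟨hw'.1, fun i b hb x hx => hw'.2 ⟨i, b, hb, x, hx⟩⟩) (Set.toFinite _))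
  have h2' : ((univ.filter fun w => ¬ bad (a, g) w).card : ℝ) ≤ _ := Nat.cast_le.2 h2
  refine le_trans ?_ h2'
  linarith

/-- The second condition on good tuples serves the auxiliary destinations, the first all others. The
map `e` need not be additive: sums are formed in `X' i` before they are embedded, and injectivity
suffices to recover them. -/
theorem SeparatesOn.equivalentUnicast {M K L : ℕ} {P : IndexCodingProblem (Fin M) (Fin K)}
    (E : P.Listing L) {X : Fin M → Type} [∀ i, AddCommGroup (X i)] {Y : Type} [AddCommGroup Y]
    {f : (∀ i, X i) → Y} {G : Set (∀ i, X i)} (h : P.SeparatesOn f G)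
    {Z : Fin M × Fin (L + 1) → Type} {X' : Fin M → Type} [∀ i, AddCommGroup (X' i)]
    (e : ∀ i, X' i → X i) (he : ∀ i, Function.Injective (e i))
    (z : ∀ i l, Z (i, Fin.succ l) → X' i) (hz : ∀ i l, Function.Injective (z i l))
    (a : ∀ i, X i) (g : (Σ i, Z (i, 0)) → Y) :
    (P.equivalentUnicast E).SeparatesOn
      (fun w : ∀ d, Z d => f (fun i => a i + e i (∑ l, z i l (w (i, l.succ)))) +
        ∑ i, g ⟨i, w (i, 0)⟩)
      {w | (fun i => a i + e i (∑ l, z i l (w (i, l.succ)))) ∈ G ∧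
        ∀ i b, b ≠ w (i, 0) → ∀ x : X' i,
          f (Function.update (fun i => a i + e i (∑ l, z i l (w (i, l.succ)))) i (a i + e i x)) +
            g ⟨i, b⟩ ≠ f (fun i => a i + e i (∑ l, z i l (w (i, l.succ)))) + g ⟨i, w (i, 0)⟩} := by
  rintro w ⟨hwG, hw⟩ w' ⟨hwG', hw'⟩ d ⟨i, j⟩ hm hf hant
  obtain rfl := mem_desired_equivalentUnicast.1 hm
  dsimp only at hf
  induction j using Fin.cases with
  | zero =>
    have hne : ∀ m j, m ≠ i → w (m, j) = w' (m, j) := fun m j hmi =>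
      hant (m, j) (mem_antidotes_equivalentUnicast_zero.2 hmi)
    by_contra hb
    -- The two tuples agree outside row i, so passing to `w'` changes only coordinate i of the input
    -- of `f`. This is exactly a collision excluded for `w`.
    have hupd : (fun m => a m + e m (∑ l, z m l (w' (m, l.succ)))) =
        Function.update (fun m => a m + e m (∑ l, z m l (w (m, l.succ)))) i
          (a i + e i (∑ l, z i l (w' (i, l.succ)))) := by
      funext m
      by_cases hmi : m = i
      · subst hmi
        simp
      · simp [Function.update_of_ne hmi, hne m _ hmi]
    refine hw i (w' (i, 0)) (Ne.symm hb) (∑ l, z i l (w' (i, l.succ))) ?_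
    rw [← hupd]
    rw [← Finset.add_sum_erase _ _ (Finset.mem_univ i),
      ← Finset.add_sum_erase (a := i) _ (fun i => g ⟨i, w' (i, 0)⟩) (Finset.mem_univ i),
      ← add_assoc, ← add_assoc,
      Finset.sum_congr rfl (g := fun m => g ⟨m, w' (m, 0)⟩) fun m hm => by
        rw [hne m 0 (Finset.ne_of_mem_erase hm)]] at hf
    exact (add_right_cancel hf).symm
  | succ l =>
    have hz0 : ∀ m, w (m, 0) = w' (m, 0) := fun m =>
      hant (m, 0) (mem_antidotes_equivalentUnicast_succ.2 (Or.inl (Or.inr rfl)))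
    simp only [hz0] at hf
    have hs := h _ hwG _ hwG' (E.dest i l) i ((E.mem_desired_iff _ _).2 ⟨l, rfl⟩)
      (add_right_cancel hf) fun m hm => by
        have : ∀ j, w (m, j) = w' (m, j) := fun j =>
          hant (m, j) (mem_antidotes_equivalentUnicast_succ.2 (Or.inl (Or.inl hm)))
        simp only [this]
    have hsum := he i (add_left_cancel hs)
    have hother : ∀ l' ∈ Finset.univ.erase l, z i l' (w (i, l'.succ)) = z i l' (w' (i, l'.succ)) :=
      fun l' hl' => by
        rw [hant (i, l'.succ) (mem_antidotes_equivalentUnicast_succ.2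
          (Or.inr ⟨rfl, fun h => Finset.ne_of_mem_erase hl' (Fin.succ_injective _ h)⟩))]
    rw [← Finset.add_sum_erase _ _ (Finset.mem_univ l),
      ← Finset.add_sum_erase (a := l) _ (fun l => z i l (w' (i, l.succ))) (Finset.mem_univ l),
      Finset.sum_congr rfl hother] at hsum
    exact hz i l (add_right_cancel hsum)

theorem SeparatesOn.exists_equivalentUnicast {M K L q : ℕ}
    {P : IndexCodingProblem (Fin M) (Fin K)} (E : P.Listing L) {N N' : Fin M → ℕ}
    {Z : Fin M × Fin (L + 1) → ℕ} {f : (∀ i, Fin (N i)) → Fin q} {G : Set (∀ i, Fin (N i))}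
    (h : P.SeparatesOn f G) (hq : 0 < q) (hN' : ∀ i, 0 < N' i) (hle : ∀ i, N' i ≤ N i)
    (hZ : ∀ i l, Z (i, Fin.succ l) = N' i) {η : ℝ}
    (hG : (1 - η) * ((∏ i, N i : ℕ) : ℝ) ≤ G.ncard) :
    ∃ (f' : (∀ w, Fin (Z w)) → Fin q) (G' : Set (∀ w, Fin (Z w))),
      (P.equivalentUnicast E).SeparatesOn f' G' ∧
      (1 - (η + ∑ i, (Z (i, 0) * N' i : ℝ) / q)) * ((∏ w, Z w : ℕ) : ℝ) ≤ G'.ncard := by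
  have : NeZero q := ⟨hq.ne'⟩
  have : ∀ i, NeZero (N i) := fun i => ⟨((hN' i).trans_le (hle i)).ne'⟩
  have : ∀ i, NeZero (N' i) := fun i => ⟨(hN' i).ne'⟩
  obtain ⟨a, g, hag⟩ := exists_shift_codebook (W := ∀ w, Fin (Z w)) (B := fun i => Fin (Z (i, 0)))
    (η := η) f G (fun i => Fin.castLE (hle i)) (fun w i => w (i, 0))
    (fun w i => ∑ l, finCongr (hZ i l) (w (i, l.succ))) (by simpa using hG)
  refine ⟨_, _, h.equivalentUnicast E _ (fun i => Fin.castLE_injective (hle i))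
    (fun i l => finCongr (hZ i l)) (fun i l => (finCongr (hZ i l)).injective) a g, ?_⟩
  refine le_trans (le_of_eq ?_) hag
  simp only [Fintype.card_pi, Fintype.card_fin]

/-- Bounds the number of competitors at an auxiliary destination. Each ceiling adds at most 1, and 0
≤ r ≤ 1 keeps both cross terms below q^(1-δ). -/
theorem ceil_rpow_mul_ceil_rpow_le {q r δ : ℝ} (hq : 1 ≤ q) (hr0 : 0 ≤ r) (hr1 : r ≤ 1)
    (hδ0 : 0 ≤ δ) (hδ1 : δ ≤ 1) :
    (⌈q ^ (1 - r - δ)⌉₊ : ℝ) * ⌈q ^ (r - δ)⌉₊ ≤ 4 * q ^ (1 - δ) := by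
  have hq0 : 0 < q := zero_lt_one.trans_le hq
  have hmono : ∀ x, x ≤ 1 - δ → q ^ x ≤ q ^ (1 - δ) := fun x hx =>
    Real.rpow_le_rpow_of_exponent_le hq hx
  have hprod : q ^ (1 - r - δ) * q ^ (r - δ) ≤ q ^ (1 - δ) := by
    rw [← Real.rpow_add hq0]
    exact hmono _ (by linarith)
  have h1 : 1 ≤ q ^ (1 - δ) := Real.one_le_rpow hq (by linarith)
  calc (⌈q ^ (1 - r - δ)⌉₊ : ℝ) * ⌈q ^ (r - δ)⌉₊
      ≤ (q ^ (1 - r - δ) + 1) * (q ^ (r - δ) + 1) :=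
        mul_le_mul (Nat.ceil_lt_add_one (by positivity)).le
          (Nat.ceil_lt_add_one (by positivity)).le (by positivity) (by positivity)
    _ = q ^ (1 - r - δ) * q ^ (r - δ) + q ^ (1 - r - δ) + q ^ (r - δ) + 1 := by ring
    _ ≤ 4 * q ^ (1 - δ) := by
        linarith [hmono (1 - r - δ) (by linarith), hmono (r - δ) (by linarith)]

theorem Achievable.equivalentUnicast {M K L : ℕ} {P : IndexCodingProblem (Fin M) (Fin K)}
    (hP : ∀ m, ∃ k, m ∈ P.desired k) (E : P.Listing L) {R : Fin M → ℝ} (hR : ∀ m, 0 ≤ R m)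
    (h : P.Achievable R) : (P.equivalentUnicast E).Achievable (unicastRates L R) := by
  have hR1 : ∀ m, R m ≤ 1 := fun m => h.le_one (hP m).choose_spec
  refine achievable_of_separatesOn fun ε δ₀ hε hδ₀ => ?_
  obtain ⟨δ, hδ, hδ1, hδδ₀⟩ : ∃ δ : ℝ, 0 < δ ∧ δ ≤ 1 ∧ δ ≤ δ₀ :=
    ⟨min 1 δ₀, by positivity, min_le_left _ _, min_le_right _ _⟩
  -- The M auxiliary destinations together contribute at most 4M q^(-δ), which this makes at most
  -- ε/2; the groupcast scheme uses the other half.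
  obtain ⟨q₀, hq₀⟩ := exists_le_rpow hδ (8 * M / ε)
  obtain ⟨q, N, f, G, hqq₀, hq1, hN, hRN, hG, hcard⟩ := h.exists_separatesOn (half_pos hε) hδ q₀
  have hq1' : (1 : ℝ) ≤ q := by exact_mod_cast hq1.le
  have hq0 : (0 : ℝ) < q := zero_lt_one.trans_le hq1'
  let B : Fin M → ℕ := fun i => ⌈(q : ℝ) ^ (1 - R i - δ)⌉₊
  -- Possibly smaller than `N i`: a message alphabet well above q^(R i) would give the auxiliary
  -- destinations too many competitors.
  let N' : Fin M → ℕ := fun i => ⌈(q : ℝ) ^ (R i - δ)⌉₊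
  let Z : Fin M × Fin (L + 1) → ℕ := fun w => Fin.cases (B w.1) (fun _ => N' w.1) w.2
  have hN'pos : ∀ i, 0 < N' i := fun i => Nat.ceil_pos.2 (by positivity)
  have hBpos : ∀ i, 0 < B i := fun i => Nat.ceil_pos.2 (by positivity)
  have hN'N : ∀ i, N' i ≤ N i := fun i => Nat.ceil_le.2 (hRN i)
  obtain ⟨f', G', hG', hcard'⟩ := hG.exists_equivalentUnicast E (Z := Z) (by omega) hN'pos hN'N
    (fun _ _ => rfl) hcard
  refine ⟨q, Z, f', G', hq1, ?_, ?_, hG', le_trans ?_ hcard'⟩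
  · rintro ⟨i, j⟩
    induction j using Fin.cases with
    | zero => exact hBpos i
    | succ l => exact hN'pos i
  · rintro ⟨i, j⟩
    refine le_trans (Real.rpow_le_rpow_of_exponent_le hq1' (sub_le_sub_left hδδ₀ _)) ?_
    induction j using Fin.cases with
    | zero => exact Nat.le_ceil ((q : ℝ) ^ (1 - R i - δ))
    | succ l =>
      rw [show unicastRates L R (i, l.succ) = R i from if_neg (Fin.succ_ne_zero l)]
      exact Nat.le_ceil ((q : ℝ) ^ (R i - δ))
  · have hterm : ∀ i, (B i * N' i : ℝ) / q ≤ 4 * (q : ℝ) ^ (-δ) := by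
      intro i
      rw [div_le_iff₀ hq0, mul_assoc, ← Real.rpow_add_one hq0.ne', neg_add_eq_sub]
      exact ceil_rpow_mul_ceil_rpow_le hq1' (hR i) (hR1 i) hδ.le hδ1
    have hsum : ∑ i, (B i * N' i : ℝ) / q ≤ ε / 2 := by
      refine (Finset.sum_le_card_nsmul _ _ _ fun i _ => hterm i).trans ?_
      have hqδ := hq₀ q hqq₀
      have hpos : (0 : ℝ) < (q : ℝ) ^ δ := by positivity
      rw [div_le_iff₀ hε] at hqδ
      rw [Finset.card_univ, Fintype.card_fin, nsmul_eq_mul, Real.rpow_neg hq0.le, ← mul_assoc,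
        ← div_eq_mul_inv, div_le_iff₀ hpos]
      linarith
    refine mul_le_mul_of_nonneg_right ?_ (Nat.cast_nonneg _)
    change 1 - ε ≤ 1 - (ε / 2 + ∑ i, (B i * N' i : ℝ) / q)
    linarith

/-! ### Existence of a listing, and the unicast property -/

theorem nonempty_listing {M K : ℕ} (P : IndexCodingProblem (Fin M) (Fin K))
    (hP : ∀ m, ∃ k, m ∈ P.desired k) : Nonempty (P.Listing K) := by
  classical
  choose c hc using hP
  -- Positions of destinations that do not desire `m` are filled with virtual copies of `c m`.
  refine ⟨⟨fun m l => if m ∈ P.desired l then l else c m, fun m k => ⟨fun h => ⟨k, if_pos h⟩, ?_⟩⟩⟩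
  rintro ⟨l, rfl⟩
  split_ifs with h
  · exact h
  · exact hc m

theorem isMultipleUnicast_equivalentUnicast {M K L : ℕ} (P : IndexCodingProblem (Fin M) (Fin K))
    (E : P.Listing L) : (P.equivalentUnicast E).IsMultipleUnicast :=
  fun _ _ h => Set.disjoint_iff_inter_eq_empty.1 (Set.disjoint_singleton.2 h)

end IndexCodingProblem

theorem theorem2 {M K : ℕ} (P : IndexCodingProblem (Fin M) (Fin K))
    (hP : ∀ m, ∃ k, m ∈ P.desired k) :
    (∃ L, Nonempty (P.Listing L)) ∧
    ∀ (L : ℕ) (E : P.Listing L),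
      (P.equivalentUnicast E).IsMultipleUnicast ∧
      ∀ R : Fin M → ℝ, (∀ m, 0 ≤ R m) →
        (P.Achievable R →
          (P.equivalentUnicast E).Achievable (IndexCodingProblem.unicastRates L R)) ∧
        (P.LinearlyAchievable R ↔
          (P.equivalentUnicast E).LinearlyAchievable (IndexCodingProblem.unicastRates L R)) :=
  ⟨⟨K, P.nonempty_listing hP⟩, fun _ E => ⟨P.isMultipleUnicast_equivalentUnicast E, fun _ hR =>
    ⟨fun h => h.equivalentUnicast hP E hR, fun h => h.equivalentUnicast hP E hR,
      fun h => h.of_equivalentUnicast hP⟩⟩⟩
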